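/- Let $\mathcal L:\mathbb C[z]\to\mathbb C$ be a positive-definite linear functional ($\mathcal L(p)>0$ for every nonzero polynomial $p$ that is nonnegative on $\mathbb R$), normalized by $\mathcal L(1)=1$, and let $$J=\begin{pmatrix} b_0&a_0&&\\ a_0&b_1&a_1&\\ &a_1&b_2&\ddots\\ &&\ddots&\ddots\end{pmatrix},\qquad a_k\ne 0,$$ be a Jacobi matrix corresponding to $\mathcal L$; that is, the polynomials $\hat P_n$ of degree $n$ defined by $\hat P_0=1$, $z\hat P_0=a_0\hat P_1+b_0\hat P_0$ and $z\hat P_k=a_k\hat P_{k+1}+b_k\hat P_k+a_{k-1}\hat P_{k-1}$ $(k\ge1)$ satisfy $\mathcal L(\hat P_m\hat P_n)=\delta_{mn}$. (The $a_k$ and $b_k$ are then real.) Assume that $J$ defines a bounded operator on $\ell^2$, again denoted by $J$, and put $m(J;z)=((J-zI)^{-1}e_0,e_0)_{\ell^2}$ with $e_0=(1,0,0,\dots)^\top$. Let $\kappa\in\mathbb C_\pm$, where $\mathbb C_\pm=\{z\in\mathbb C:\pm\operatorname{Im}z>0\}$, let $\mathcal L^{-*}$ be a Geronimus transformation of $\mathcal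 L$ at $\kappa$, i.e. a linear functional on $\mathbb C[z]$ with $\mathcal L^{-*}((z-\kappa)p(z))=\mathcal L(p(z))$ for all polynomials $p$, and suppose that $$s_0^*:=\mathcal L^{-*}(1)\in\overline{\mathbb C}_\mp\setminus\{0,m(J;\kappa)\},$$ where $\overline{\mathbb C}_\mp$ is the closed half-plane opposite to that of $\kappa$. Then the matrix $J-\kappa I$ has a factorization $$J-\kappa I=\mathcal U\mathcal D\,\mathcal U^\top,\qquad \mathcal D=\operatorname{diag}(t_0,t_1,\dots),\qquad \mathcal U=\begin{pmatrix}u_0&1&&\\ &u_1&1&\\ &&\ddots&\ddots\end{pmatrix},\qquad t_0=1,\quad u_0^2=\frac1{s_0^*}.$$ Moreover, for every such factorization and every choice of square roots in $U=\mathcal U\mathcal D^{1/2}$, the matrices $U$ and $U^\top$ define bounded operators on $\ell^2$, $J-\kappa I=UU^\top$, and the Geronimus transform $J_G(\kappa)=U^\top U+\kappa I$ satisfies $$\sigma(J_G(\kappa))=\sigma(J)\cup\{\kappa\}.$$ -/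

import Mathlib

noncomputable section

/-- A linear functional `L` on `ℂ[z]` is positive-definite if `L p > 0` for every nonzero polynomial
`p` that is nonnegative on the real line (such a `p` has real coefficients). -/
def IsPositiveDefinite (L : Polynomial ℂ →ₗ[ℂ] ℂ) : Prop :=
  ∀ p : Polynomial ℝ, p ≠ 0 → (∀ x : ℝ, 0 ≤ p.eval x) →
    ∃ r : ℝ, 0 < r ∧ L (p.map (algebraMap ℝ ℂ)) = (r : ℂ)

/-- The symmetric tridiagonal (complex Jacobi) matrix with diagonal `b` and off-diagonal `a`. -/
def jacobiMatrix (a b : ℕ → ℂ) : Matrix ℕ ℕ ℂ := fun i j =>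
  if j = i then b i else if j = i + 1 then a i else if i = j + 1 then a j else 0

/-- The Jacobi matrix with entries `a`, `b` corresponds to the functional `L`: the off-diagonal
entries do not vanish, and the polynomials `p n` defined by the three-term recurrence with
`p 0 = 1` are orthonormal for the (bilinear) form of `L`. In particular `L 1 = 1`. -/
def CorrespondsTo (a b : ℕ → ℂ) (L : Polynomial ℂ →ₗ[ℂ] ℂ) : Prop :=
  (∀ k, a k ≠ 0) ∧
  ∃ p : ℕ → Polynomial ℂ,
    p 0 = 1 ∧
    Polynomial.X * p 0 = Polynomial.C (a 0) * p 1 + Polynomial.C (b 0) * p 0 ∧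
    (∀ k, Polynomial.X * p (k + 1) =
      Polynomial.C (a (k + 1)) * p (k + 2) + Polynomial.C (b (k + 1)) * p (k + 1)
        + Polynomial.C (a k) * p k) ∧
    (∀ n, (p n).natDegree = n) ∧
    (∀ m n, L (p m * p n) = if m = n then 1 else 0)

/-- `LG` is a Geronimus transformation of `L` at `κ`: `LG ((z - κ) p) = L p` for all `p`.
The value `LG 1` is a free parameter. -/
def IsGeronimusTransformation (κ : ℂ) (L LG : Polynomial ℂ →ₗ[ℂ] ℂ) : Prop :=
  ∀ p : Polynomial ℂ, LG ((Polynomial.X - Polynomial.C κ) * p) = L p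

/-- The Hilbert space of square-summable complex sequences. -/
abbrev EllTwo : Type := lp (fun _ : ℕ => ℂ) 2

/-- The `j`-th standard basis vector of `ℓ²`. -/
def stdVec (j : ℕ) : EllTwo := lp.single 2 j (1 : ℂ)

/-- The bounded operator `T` on `ℓ²` is the one given by the infinite matrix `A`. -/
def HasMatrix (T : EllTwo →L[ℂ] EllTwo) (A : Matrix ℕ ℕ ℂ) : Prop :=
  ∀ i j, (T (stdVec j) : ℕ → ℂ) i = A i j

/-- The Weyl function `m(J; z) = ((J - z I)⁻¹ e₀, e₀)`. (Mathlib's inner product is linear in the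
second argument.) -/
def weylM (J : EllTwo →L[ℂ] EllTwo) (z : ℂ) : ℂ :=
  inner ℂ (stdVec 0) (Ring.inverse (J - z • (1 : EllTwo →L[ℂ] EllTwo)) (stdVec 0))

/-- The upper bidiagonal matrix with diagonal `u 0, u 1, …` and superdiagonal `1, 1, …`. -/
def unitUpper (u : ℕ → ℂ) : Matrix ℕ ℕ ℂ := fun i j =>
  if j = i then u i else if j = i + 1 then 1 else 0

/-- The sequences `t`, `u` give the UL-factorization
`J - κ I = 𝒰 diag(t) 𝒰ᵀ` of the (matrix) `J - κ I`, normalized by `t 0 = 1`, `(u 0)² = 1 / s`.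
Each row of `𝒰` has at most two nonzero entries, so the sum is finite. -/
def IsULFactorization (a b : ℕ → ℂ) (κ s : ℂ) (t u : ℕ → ℂ) : Prop :=
  t 0 = 1 ∧ u 0 ^ 2 = 1 / s ∧
  ∀ i j, jacobiMatrix a b i j - (if i = j then κ else 0)
    = ∑ᶠ k, unitUpper u i k * t k * unitUpper u j k

/-- The matrix `U = 𝒰 diag(r)`, where `r` is a sequence of square roots of `t`. -/
def upperFactor (u r : ℕ → ℂ) : Matrix ℕ ℕ ℂ := fun i j => unitUpper u i j * r j

end

/-!
Multiplying out `J - κ = 𝒰 diag(t) 𝒰ᵀ` shows that the numbers `d k = (u k)² t k` and the pivots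
`t (k + 1) = b k - κ - d k` follow the continued fraction `d 0 = 1 / s`,
`d (k + 1) = (a k)² / t (k + 1)` (`isULFactorization_iff`). Positivity of the functional makes the
Jacobi entries real (`CorrespondsTo.im_eq_zero`). Since `s` lies in the closed half-plane opposite
to `κ`, every `d k` then lies in the closed half-plane of `κ` (`ulDiag_im`), so that
`|t (k + 1)| ≥ |Im κ|` (`abs_im_le_norm_pivot`). Hence the recursion never breaks down
(`exists_isULFactorization`), and as `a`, `b` are bounded so are the entries of
`U = 𝒰 diag(t) ^ (1/2)` (`IsULFactorization.bounded`); the bounded bidiagonal operators `U`, `Uᵀ`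
come from `exists_bidiagonal`.

For the spectrum, `J` is self-adjoint and `κ` is not real, so `U Uᵀ = J - κ` is invertible. The
spectra of `U Uᵀ` and `Uᵀ U` agree away from `0`, and it remains to see that `Uᵀ U` is not
invertible. Otherwise `U` is injective, and comparing `U (Uᵀ f) = e₀`, `f = (J - κ)⁻¹ e₀`, with the
first column of `U` gives `m(J; κ) = 1 / (u 0)² = s` (`inner_inverse_mul_stdVec_zero`), which is the
excluded value of `s`.
-/

/-! ### Reality of the Jacobi entries -/

open Polynomial in
/-- A positive-definite functional takes real values on real polynomials: a real polynomial is the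
difference of the squares of `(q ± 1) / 2`. -/
theorem IsPositiveDefinite.exists_real_map {L : Polynomial ℂ →ₗ[ℂ] ℂ} (hL : IsPositiveDefinite L)
    (q : Polynomial ℝ) : ∃ x : ℝ, L (q.map (algebraMap ℝ ℂ)) = x := by
  have sq (g : Polynomial ℝ) : ∃ x : ℝ, L ((g ^ 2).map (algebraMap ℝ ℂ)) = x := by
    by_cases hg : g ^ 2 = 0
    · exact ⟨0, by simp [hg]⟩
    · obtain ⟨x, -, hx⟩ := hL (g ^ 2) hg fun x => by rw [eval_pow]; positivity
      exact ⟨x, hx⟩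
  obtain ⟨x, hx⟩ := sq (C (1 / 2) * (q + 1))
  obtain ⟨y, hy⟩ := sq (C (1 / 2) * (q - 1))
  have hq : q = (C (1 / 2) * (q + 1)) ^ 2 - (C (1 / 2) * (q - 1)) ^ 2 := by
    have h4 : (C (1 / 2) : Polynomial ℝ) ^ 2 * 4 = 1 := by
      rw [← C_pow, show (4 : Polynomial ℝ) = C 4 from rfl, ← C_mul, ← C_1]
      norm_num
    linear_combination -q * h4
  refine ⟨x - y, ?_⟩
  rw [hq, Polynomial.map_sub, map_sub, hx, hy]
  push_cast
  rfl

/-- A complex number whose square is a positive real is real. -/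
theorem Complex.im_eq_zero_of_sq_eq_ofReal_pos {z : ℂ} {x : ℝ} (hx : 0 < x) (h : z ^ 2 = x) :
    z.im = 0 := by
  have hre := congrArg Complex.re h
  have him := congrArg Complex.im h
  simp only [pow_two, Complex.mul_re, Complex.mul_im, Complex.ofReal_re, Complex.ofReal_im]
    at hre him
  have : z.re * z.im = 0 := by linarith
  rcases mul_eq_zero.1 this with h0 | h0
  · rw [h0] at hre
    nlinarith [sq_nonneg z.im]
  · exact h0

open Polynomial in
/-- The entries of a Jacobi matrix corresponding to a positive-definite functional are real. With
`p n` real, `b n = L (z (p n)²)` is real; then `q = a n * p (n + 1)` is real, and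
`(a n)² = L (q²) > 0` forces `a n`, hence `p (n + 1)`, to be real. -/
theorem CorrespondsTo.im_eq_zero {L : Polynomial ℂ →ₗ[ℂ] ℂ} (hL : IsPositiveDefinite L)
    {a b : ℕ → ℂ} (hab : CorrespondsTo a b L) (n : ℕ) : (a n).im = 0 ∧ (b n).im = 0 := by
  obtain ⟨ha, p, h0, hrec0, hrec, -, horth⟩ := hab
  -- `low n` is the term of index `n - 1` in the recurrence, absent for `n = 0`.
  let low : ℕ → Polynomial ℂ := fun n => Nat.casesOn n 0 fun k => C (a k) * p k
  have hrec' : ∀ n, X * p n = C (a n) * p (n + 1) + C (b n) * p n + low n := by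
    rintro (_ | k)
    · simpa [low] using hrec0
    · exact hrec k
  have hlow : ∀ n, L (p n * low n) = 0 := by
    rintro (_ | k)
    · simp [low]
    · have : p (k + 1) * low (k + 1) = a k • (p (k + 1) * p k) := by
        simp only [low, smul_eq_C_mul]; ring
      rw [this, map_smul, horth, if_neg (by omega), smul_zero]
  have key : ∀ n, (∃ q : Polynomial ℝ, q.map (algebraMap ℝ ℂ) = p n) →
      (∃ q : Polynomial ℝ, q.map (algebraMap ℝ ℂ) = low n) →
      ((a n).im = 0 ∧ (b n).im = 0) ∧ ∃ q : Polynomial ℝ, q.map (algebraMap ℝ ℂ) = p (n + 1) := by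
    rintro n ⟨q, hq⟩ ⟨l, hl⟩
    obtain ⟨β, hβ⟩ : ∃ β : ℝ, b n = β := by
      obtain ⟨x, hx⟩ := hL.exists_real_map (X * q * q)
      refine ⟨x, ?_⟩
      rw [← hx, Polynomial.map_mul, Polynomial.map_mul, map_X, hq, hrec' n]
      have : (C (a n) * p (n + 1) + C (b n) * p n + low n) * p n
          = a n • (p (n + 1) * p n) + b n • (p n * p n) + p n * low n := by
        simp only [smul_eq_C_mul]; ring
      rw [this, map_add, map_add, map_smul, map_smul, hlow, horth, horth]
      simp
    set g : Polynomial ℝ := X * q - C β * q - l with hg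
    have hgm : g.map (algebraMap ℝ ℂ) = C (a n) * p (n + 1) := by
      rw [hg, Polynomial.map_sub, Polynomial.map_sub, Polynomial.map_mul, Polynomial.map_mul,
        map_X, map_C, hq, hl, hrec' n, hβ]
      simp only [Complex.coe_algebraMap]
      ring
    have hLg : L ((g ^ 2).map (algebraMap ℝ ℂ)) = a n ^ 2 := by
      have : (g ^ 2).map (algebraMap ℝ ℂ) = a n ^ 2 • (p (n + 1) * p (n + 1)) := by
        rw [Polynomial.map_pow, hgm, smul_eq_C_mul, C_pow]; ring
      rw [this, map_smul, horth, if_pos rfl, smul_eq_mul, mul_one]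
    have hg0 : g ^ 2 ≠ 0 := by
      intro h
      rw [h, Polynomial.map_zero, map_zero] at hLg
      exact ha n (pow_eq_zero_iff two_ne_zero |>.1 hLg.symm)
    obtain ⟨x, hx0, hx⟩ := hL (g ^ 2) hg0 fun x => by rw [eval_pow]; positivity
    have haim : (a n).im = 0 :=
      Complex.im_eq_zero_of_sq_eq_ofReal_pos hx0 (hLg.symm.trans hx)
    have hare : a n = ((a n).re : ℂ) := Complex.ext rfl (by simpa using haim)
    refine ⟨⟨haim, by simp [hβ]⟩, C (a n).re⁻¹ * g, ?_⟩
    rw [Polynomial.map_mul, hgm, map_C, Complex.coe_algebraMap, Complex.ofReal_inv, ← hare,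
      ← mul_assoc, ← C_mul, inv_mul_cancel₀ (ha n), C_1, one_mul]
  have real : ∀ n, (∃ q : Polynomial ℝ, q.map (algebraMap ℝ ℂ) = p n) ∧
      ∃ q : Polynomial ℝ, q.map (algebraMap ℝ ℂ) = low n := by
    intro n
    induction n with
    | zero => exact ⟨⟨1, by simp [h0]⟩, ⟨0, by simp [low]⟩⟩
    | succ n ih =>
      obtain ⟨⟨haim, -⟩, hp⟩ := key n ih.1 ih.2
      obtain ⟨q, hq⟩ := ih.1
      have hare : a n = ((a n).re : ℂ) := Complex.ext rfl (by simpa using haim)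
      refine ⟨hp, C (a n).re * q, ?_⟩
      rw [Polynomial.map_mul, hq, map_C, Complex.coe_algebraMap, ← hare]
  exact (key n (real n).1 (real n).2).1

/-! ### Bounded operators on `ℓ²` and their matrices -/

theorem stdVec_apply (j i : ℕ) : (stdVec j : ℕ → ℂ) i = if i = j then 1 else 0 := by
  rw [stdVec, lp.single_apply, Pi.single_apply]

theorem inner_stdVec (i : ℕ) (x : EllTwo) : inner ℂ (stdVec i) x = (x : ℕ → ℂ) i := by
  simp [stdVec, lp.inner_single_left]

theorem norm_stdVec (i : ℕ) : ‖stdVec i‖ = 1 := by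
  rw [stdVec, lp.norm_single (by norm_num), norm_one]

theorem ext_stdVec {S T : EllTwo →L[ℂ] EllTwo} (h : ∀ j, S (stdVec j) = T (stdVec j)) : S = T := by
  refine lp.ext_continuousLinearMap (by norm_num) fun i => ?_
  ext1
  exact h i

/-- A bounded operator is determined by its matrix. -/
theorem HasMatrix.unique {S T : EllTwo →L[ℂ] EllTwo} {A : Matrix ℕ ℕ ℂ}
    (hS : HasMatrix S A) (hT : HasMatrix T A) : S = T :=
  ext_stdVec fun j => lp.ext (funext fun i => (hS i j).trans (hT i j).symm)

theorem HasMatrix.norm_le {T : EllTwo →L[ℂ] EllTwo} {A : Matrix ℕ ℕ ℂ} (hT : HasMatrix T A)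
    (i j : ℕ) : ‖A i j‖ ≤ ‖T‖ := by
  rw [← hT i j]
  calc ‖(T (stdVec j) : ℕ → ℂ) i‖ ≤ ‖T (stdVec j)‖ := lp.norm_apply_le_norm two_ne_zero _ _
    _ ≤ ‖T‖ * ‖stdVec j‖ := T.le_opNorm _
    _ = ‖T‖ := by rw [norm_stdVec, mul_one]

/-- An operator with a Hermitian matrix is self-adjoint. -/
theorem HasMatrix.isSelfAdjoint {T : EllTwo →L[ℂ] EllTwo} {A : Matrix ℕ ℕ ℂ} (hT : HasMatrix T A)
    (hA : ∀ i j, star (A j i) = A i j) : IsSelfAdjoint T := by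
  rw [ContinuousLinearMap.isSelfAdjoint_iff']
  refine HasMatrix.unique (A := A) (fun i j => ?_) hT
  rw [← inner_stdVec, ContinuousLinearMap.adjoint_inner_right, ← inner_conj_symm, inner_stdVec,
    hT j i]
  exact hA i j

/-- Multiplication of the coordinates by a bounded sequence. -/
noncomputable def diagonalOp (c : ℕ → ℂ) (C : ℝ) (hc : ∀ k, ‖c k‖ ≤ C) : EllTwo →L[ℂ] EllTwo :=
  have bound (x : EllTwo) (k : ℕ) : ‖c k * x k‖ ≤ ‖((C : ℂ) • x : EllTwo) k‖ := by
    rw [lp.coeFn_smul, Pi.smul_apply, smul_eq_mul, norm_mul, norm_mul, Complex.norm_real]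
    exact mul_le_mul_of_nonneg_right ((hc k).trans (Real.le_norm_self C)) (norm_nonneg _)
  LinearMap.mkContinuous
    { toFun := fun x => ⟨fun k => c k * x k, (lp.memℓp ((C : ℂ) • x)).mono' (bound x)⟩
      map_add' := fun x y => lp.ext (funext fun k => mul_add (c k) (x k) (y k))
      map_smul' := fun z x => lp.ext (funext fun k => mul_left_comm (c k) z (x k)) }
    ‖(C : ℂ)‖ fun x => (lp.norm_mono two_ne_zero (y := (C : ℂ) • x) (bound x)).trans
      (lp.norm_const_smul_le two_ne_zero _ _)

theorem diagonalOp_apply (c : ℕ → ℂ) (C : ℝ) (hc : ∀ k, ‖c k‖ ≤ C) (x : EllTwo) (k : ℕ) :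
    (diagonalOp c C hc x : ℕ → ℂ) k = c k * x k := rfl

/-- The backward shift `(x₀, x₁, …) ↦ (x₁, x₂, …)`. -/
noncomputable def backwardShift : EllTwo →L[ℂ] EllTwo :=
  have pos : 0 < (2 : ENNReal).toReal := by norm_num
  LinearMap.mkContinuous
    { toFun := fun x => ⟨fun k => x (k + 1), memℓp_gen
        (((lp.memℓp x).summable pos).comp_injective (add_left_injective 1))⟩
      map_add' := fun _ _ => rfl
      map_smul' := fun _ _ => rfl }
    1 fun x => by
      rw [one_mul]
      refine lp.norm_le_of_tsum_le pos (norm_nonneg x) ?_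
      rw [lp.norm_rpow_eq_tsum pos x]
      exact tsum_comp_le_tsum_of_inj ((lp.memℓp x).summable pos)
        (fun _ => by positivity) (add_left_injective 1)

theorem backwardShift_apply (x : EllTwo) (k : ℕ) : (backwardShift x : ℕ → ℂ) k = x (k + 1) := rfl

theorem adjoint_backwardShift_apply_zero (x : EllTwo) :
    (backwardShift.adjoint x : ℕ → ℂ) 0 = 0 := by
  have : backwardShift (stdVec 0) = 0 :=
    lp.ext (funext fun k => by simp [backwardShift_apply, stdVec_apply])
  rw [← inner_stdVec, ContinuousLinearMap.adjoint_inner_right, this, inner_zero_left]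

theorem adjoint_backwardShift_apply_succ (x : EllTwo) (k : ℕ) :
    (backwardShift.adjoint x : ℕ → ℂ) (k + 1) = x k := by
  have : backwardShift (stdVec (k + 1)) = stdVec k :=
    lp.ext (funext fun i => by simp [backwardShift_apply, stdVec_apply])
  rw [← inner_stdVec, ContinuousLinearMap.adjoint_inner_right, this, inner_stdVec]

/-- Bounded sequences `α`, `β` define a bounded upper bidiagonal operator together with its
transpose. -/
theorem exists_bidiagonal {α β : ℕ → ℂ} {C : ℝ} (hα : ∀ k, ‖α k‖ ≤ C) (hβ : ∀ k, ‖β k‖ ≤ C) :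
    ∃ U Ut : EllTwo →L[ℂ] EllTwo,
      (∀ x k, (U x : ℕ → ℂ) k = α k * x k + β k * x (k + 1)) ∧
      (∀ x, (Ut x : ℕ → ℂ) 0 = α 0 * x 0) ∧
      ∀ x k, (Ut x : ℕ → ℂ) (k + 1) = α (k + 1) * x (k + 1) + β k * x k := by
  refine ⟨diagonalOp α C hα + diagonalOp β C hβ * backwardShift,
    diagonalOp α C hα + backwardShift.adjoint * diagonalOp β C hβ,
    fun x k => rfl, fun x => ?_, fun x k => ?_⟩
  · change α 0 * x 0 + (backwardShift.adjoint (diagonalOp β C hβ x) : ℕ → ℂ) 0 = _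
    rw [adjoint_backwardShift_apply_zero, add_zero]
  · change α (k + 1) * x (k + 1) +
      (backwardShift.adjoint (diagonalOp β C hβ x) : ℕ → ℂ) (k + 1) = _
    rw [adjoint_backwardShift_apply_succ, diagonalOp_apply]

/-! ### The UL-factorization and its continued fraction -/

theorem jacobiMatrix_diag (a b : ℕ → ℂ) (k : ℕ) : jacobiMatrix a b k k = b k := by
  simp [jacobiMatrix]

theorem jacobiMatrix_succ_right (a b : ℕ → ℂ) (k : ℕ) : jacobiMatrix a b k (k + 1) = a k := by
  simp [jacobiMatrix]

theorem jacobiMatrix_comm (a b : ℕ → ℂ) (i j : ℕ) : jacobiMatrix a b i j = jacobiMatrix a b j i := by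
  unfold jacobiMatrix
  split_ifs <;> first | omega | simp_all

/-- Row `i` of `unitUpper u` is supported on the columns `i` and `i + 1`. -/
theorem finsum_unitUpper (t u : ℕ → ℂ) (i j : ℕ) :
    ∑ᶠ k, unitUpper u i k * t k * unitUpper u j k =
      u i * t i * unitUpper u j i + t (i + 1) * unitUpper u j (i + 1) := by
  rw [finsum_eq_sum_of_support_subset (s := {i, i + 1}), Finset.sum_pair (by omega)]
  · simp [unitUpper]
  · intro k hk
    by_contra hne
    simp only [Finset.coe_insert, Finset.coe_singleton, Set.mem_insert_iff,
      Set.mem_singleton_iff, not_or] at hne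
    exact hk (by simp [unitUpper, hne.1, hne.2])

/-- The factorization `J - κ = 𝒰 diag(t) 𝒰ᵀ`, read off on the diagonal and above it. -/
theorem isULFactorization_iff {a b : ℕ → ℂ} {κ s : ℂ} {t u : ℕ → ℂ} :
    IsULFactorization a b κ s t u ↔ t 0 = 1 ∧ u 0 ^ 2 = 1 / s ∧
      (∀ k, b k - κ = u k ^ 2 * t k + t (k + 1)) ∧ ∀ k, a k = t (k + 1) * u (k + 1) := by
  simp only [IsULFactorization, finsum_unitUpper]
  refine and_congr_right fun _ => and_congr_right fun _ => ⟨fun h => ⟨fun k => ?_, fun k => ?_⟩, ?_⟩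
  · have := h k k
    simp only [jacobiMatrix, unitUpper, if_true] at this
    rw [this, if_neg (by omega)]
    ring
  · have := h k (k + 1)
    simp only [jacobiMatrix, unitUpper, if_true] at this
    simpa [show k ≠ k + 1 + 1 by omega] using this
  · rintro ⟨hb, ha⟩ i j
    rcases lt_trichotomy i j with hij | rfl | hij
    · obtain rfl | hij' := (Nat.succ_le_of_lt hij).eq_or_lt
      · simp [jacobiMatrix, unitUpper, ha i, show i ≠ i + 1 + 1 by omega]
      · have h1 : j ≠ i := by omega
        have h2 : j ≠ i + 1 := by omega
        have h3 : i ≠ j + 1 := by omega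
        have h4 : i ≠ j := by omega
        simp [jacobiMatrix, unitUpper, h1, h2, h3, h4, h2.symm]
    · have := hb i
      simp [jacobiMatrix, unitUpper, this]
      ring
    · obtain rfl | hij' := (Nat.succ_le_of_lt hij).eq_or_lt
      · simp [jacobiMatrix, unitUpper, ha j, show j ≠ j + 1 + 1 by omega,
          show j + 1 + 1 ≠ j by omega, mul_comm]
      · have h1 : j ≠ i := by omega
        have h2 : j ≠ i + 1 := by omega
        have h3 : i ≠ j + 1 := by omega
        have h4 : i ≠ j := by omega
        simp [jacobiMatrix, unitUpper, h1, h2, h3, h4]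
        omega

/-- The continued fraction `d 0 = 1 / s`, `d (k + 1) = (a k)² / (b k - κ - d k)`, whose terms are
the numbers `(u k)² t k` of the factorization. The denominators do not vanish for `s` and `κ` in
opposite half-planes, by `abs_im_le_norm_pivot` and `ulDiag_im`. -/
noncomputable def ulDiag (a b : ℕ → ℂ) (κ s : ℂ) : ℕ → ℂ
  | 0 => 1 / s
  | k + 1 => a k ^ 2 / (b k - κ - ulDiag a b κ s k)

section
variable {a b : ℕ → ℂ} {κ s : ℂ}

/-- The pivot `b k - κ - d k` stays away from the real line once `d k` lies in the half-plane of
`κ`. -/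
theorem abs_im_le_norm_pivot (hκ : κ.im ≠ 0) {β d : ℂ} (hβ : β.im = 0) (hd : 0 ≤ κ.im * d.im) :
    |κ.im| ≤ ‖β - κ - d‖ := by
  refine le_trans ?_ (Complex.abs_im_le_norm _)
  rw [Complex.sub_im, Complex.sub_im, hβ]
  refine le_of_mul_le_mul_left ?_ (abs_pos.2 hκ)
  rw [← abs_mul, ← abs_mul, abs_of_nonneg (mul_self_nonneg κ.im)]
  refine le_trans ?_ (neg_le_abs _)
  linarith

/-- The half-plane of `κ` is invariant under `d ↦ a² / (b - κ - d)` with real `a`, `b`. -/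
theorem ulDiag_im (hab : ∀ n, (a n).im = 0 ∧ (b n).im = 0) (hs : κ.im * s.im ≤ 0) (k : ℕ) :
    0 ≤ κ.im * (ulDiag a b κ s k).im := by
  induction k with
  | zero =>
    rw [ulDiag, one_div, Complex.inv_im, mul_div_assoc']
    exact div_nonneg (by linarith) (Complex.normSq_nonneg s)
  | succ k ih =>
    have hare : a k = ((a k).re : ℂ) := Complex.ext rfl (by simpa using (hab k).1)
    rw [ulDiag, hare, div_eq_mul_inv, ← Complex.ofReal_pow, Complex.im_ofReal_mul,
      Complex.inv_im, Complex.sub_im, Complex.sub_im, (hab k).2, mul_left_comm, mul_div_assoc']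
    refine mul_nonneg (sq_nonneg _) (div_nonneg ?_ (Complex.normSq_nonneg _))
    nlinarith [sq_nonneg κ.im]

theorem exists_isULFactorization (hκ : κ.im ≠ 0) (hab : ∀ n, (a n).im = 0 ∧ (b n).im = 0)
    (hs : κ.im * s.im ≤ 0) : ∃ t u : ℕ → ℂ, IsULFactorization a b κ s t u := by
  set d := ulDiag a b κ s with hd
  have hpiv : ∀ k, b k - κ - d k ≠ 0 := fun k h => by
    have := abs_im_le_norm_pivot hκ (hab k).2 (ulDiag_im hab hs k)
    rw [← hd, h, norm_zero] at this
    exact (abs_pos.2 hκ).not_ge this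
  obtain ⟨v, hv⟩ := IsAlgClosed.exists_pow_nat_eq (1 / s) two_pos
  set t : ℕ → ℂ := fun k => Nat.casesOn k 1 fun k => b k - κ - d k with ht
  set u : ℕ → ℂ := fun k => Nat.casesOn k v fun k => a k / (b k - κ - d k) with hu
  have hdk : ∀ k, u k ^ 2 * t k = d k := by
    rintro (_ | k)
    · simp [hu, ht, hd, ulDiag, hv]
    · have := hpiv k
      simp only [hu, ht, hd, ulDiag]
      rw [← hd]
      field_simp
  refine ⟨t, u, isULFactorization_iff.2 ⟨rfl, hv, fun k => ?_, fun k => ?_⟩⟩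
  · rw [hdk]
    simp [ht]
  · exact (mul_div_cancel₀ (a k) (hpiv k)).symm

theorem IsULFactorization.sq_mul_eq_ulDiag {t u : ℕ → ℂ} (h : IsULFactorization a b κ s t u)
    (ha : ∀ k, a k ≠ 0) (k : ℕ) : u k ^ 2 * t k = ulDiag a b κ s k := by
  obtain ⟨h0, hu0, hb, hak⟩ := isULFactorization_iff.1 h
  induction k with
  | zero => rw [h0, hu0, mul_one, ulDiag]
  | succ k ih =>
    have ht : t (k + 1) ≠ 0 := fun h0 => ha k (by rw [hak k, h0, zero_mul])
    rw [ulDiag, ← ih, hb k, hak k, add_sub_cancel_left, eq_div_iff ht]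
    ring

/-- In a factorization of a bounded Jacobi matrix the entries `(u k)² t k` and `t (k + 1)` of the
squared factor are bounded, because the pivots `t (k + 1)` are bounded below by `|Im κ|`. -/
theorem IsULFactorization.bounded {t u : ℕ → ℂ} (h : IsULFactorization a b κ s t u)
    (ha : ∀ k, a k ≠ 0) (hκ : κ.im ≠ 0) (hab : ∀ n, (a n).im = 0 ∧ (b n).im = 0)
    (hs : κ.im * s.im ≤ 0) {M : ℝ} (haM : ∀ k, ‖a k‖ ≤ M) (hbM : ∀ k, ‖b k‖ ≤ M) :
    ∃ C : ℝ, ∀ k, ‖u k ^ 2 * t k‖ ≤ C ∧ ‖t (k + 1)‖ ≤ C := by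
  obtain ⟨-, -, hb, hak⟩ := isULFactorization_iff.1 h
  set D : ℝ := max ‖1 / s‖ (M ^ 2 / |κ.im|) with hD
  have hd : ∀ k, ‖ulDiag a b κ s k‖ ≤ D := by
    rintro (_ | k)
    · exact le_max_left _ _
    · refine le_trans ?_ (le_max_right _ _)
      rw [ulDiag, norm_div, norm_pow]
      exact div_le_div₀ (sq_nonneg M) (pow_le_pow_left₀ (norm_nonneg _) (haM k) 2)
        (abs_pos.2 hκ) (abs_im_le_norm_pivot hκ (hab k).2 (ulDiag_im hab hs k))
  refine ⟨M + ‖κ‖ + D, fun k => ⟨?_, ?_⟩⟩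
  · rw [h.sq_mul_eq_ulDiag ha]
    linarith [hd k, (norm_nonneg _).trans (haM 0), norm_nonneg κ]
  · have : t (k + 1) = b k - κ - ulDiag a b κ s k := by
      rw [← h.sq_mul_eq_ulDiag ha, hb k]; ring
    rw [this]
    calc ‖b k - κ - ulDiag a b κ s k‖ ≤ ‖b k - κ‖ + ‖ulDiag a b κ s k‖ := norm_sub_le _ _
      _ ≤ ‖b k‖ + ‖κ‖ + ‖ulDiag a b κ s k‖ := by gcongr; exact norm_sub_le _ _
      _ ≤ M + ‖κ‖ + D := by gcongr; exacts [hbM k, hd k]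

end

/-! ### Spectra of the two products of the factors -/

/-- If `U` has first column `ρ e₀`, `Ut` has first row `ρ e₀ᵀ`, `U * Ut` is invertible and `U` is
injective, then the first diagonal entry of `(U * Ut)⁻¹` is `1 / ρ²`: for `f = (U * Ut)⁻¹ e₀` the
equations `U (Ut f) = e₀ = U (ρ⁻¹ e₀)` give `Ut f = ρ⁻¹ e₀`, whose first coordinate is `ρ f₀`. -/
theorem inner_inverse_mul_stdVec_zero {U Ut : EllTwo →L[ℂ] EllTwo} {ρ : ℂ} (hρ : ρ ≠ 0)
    (hU0 : U (stdVec 0) = ρ • stdVec 0) (hUt0 : ∀ x, (Ut x : ℕ → ℂ) 0 = ρ * x 0)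
    (hunit : IsUnit (U * Ut)) (hinj : Function.Injective U) :
    inner ℂ (stdVec 0) (Ring.inverse (U * Ut) (stdVec 0)) = 1 / ρ ^ 2 := by
  set f := Ring.inverse (U * Ut) (stdVec 0) with hf
  have hUf : U (Ut f) = stdVec 0 := by
    have := congrArg (fun T : EllTwo →L[ℂ] EllTwo => T (stdVec 0)) (Ring.mul_inverse_cancel _ hunit)
    exact this
  have hUtf : Ut f = ρ⁻¹ • stdVec 0 := hinj (by
    rw [hUf, map_smul, hU0, smul_smul, inv_mul_cancel₀ hρ, one_smul])
  have h0 : ρ * (f : ℕ → ℂ) 0 = ρ⁻¹ := by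
    rw [← hUt0, hUtf, lp.coeFn_smul, Pi.smul_apply, stdVec_apply, if_pos rfl, smul_eq_mul, mul_one]
  rw [inner_stdVec, eq_div_iff (pow_ne_zero 2 hρ)]
  calc (f : ℕ → ℂ) 0 * ρ ^ 2 = ρ * (f : ℕ → ℂ) 0 * ρ := by ring
    _ = 1 := by rw [h0, inv_mul_cancel₀ hρ]

/-- Interchanging the factors of an invertible product adds the point `0` to the spectrum, unless
the other product is invertible as well. -/
theorem spectrum_mul_comm_eq_union_zero {A : Type*} [Ring A] [Algebra ℂ A] {x y : A}
    (hxy : IsUnit (x * y)) (hyx : ¬IsUnit (y * x)) :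
    spectrum ℂ (y * x) = spectrum ℂ (x * y) ∪ {0} := by
  have h0 : (0 : ℂ) ∈ spectrum ℂ (y * x) := (spectrum.zero_mem_iff ℂ).2 hyx
  have h0' : (0 : ℂ) ∉ spectrum ℂ (x * y) := (spectrum.zero_notMem_iff ℂ).2 hxy
  rw [← Set.sdiff_singleton_eq_self h0', spectrum.nonzero_mul_comm, Set.sdiff_union_self,
    Set.union_eq_self_of_subset_right (Set.singleton_subset_iff.2 h0)]

theorem spectrum_add_smul_one {A : Type*} [Ring A] [Algebra ℂ A] (x : A) (κ : ℂ) :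
    spectrum ℂ (x + κ • (1 : A)) = (· + κ) '' spectrum ℂ x := by
  rw [← Algebra.algebraMap_eq_smul_one, ← spectrum.add_singleton_eq, Set.add_singleton]

theorem norm_le_of_sq_eq {x y : ℂ} {C : ℝ} (hxy : x ^ 2 = y) (hy : ‖y‖ ≤ C) : ‖x‖ ≤ C + 1 := by
  rw [← hxy, norm_pow] at hy
  nlinarith [sq_nonneg (‖x‖ - 1), norm_nonneg x]

theorem mainTheorem2
    (L LG : Polynomial ℂ →ₗ[ℂ] ℂ) (hL : IsPositiveDefinite L)
    (a b : ℕ → ℂ) (hab : CorrespondsTo a b L)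
    (J : EllTwo →L[ℂ] EllTwo) (hJ : HasMatrix J (jacobiMatrix a b))
    (κ : ℂ) (hLG : IsGeronimusTransformation κ L LG)
    (s : ℂ) (hs : s = LG 1)
    (hκs : (0 < κ.im ∧ s.im ≤ 0) ∨ (κ.im < 0 ∧ 0 ≤ s.im))
    (hs0 : s ≠ 0) (hsm : s ≠ weylM J κ) :
    (∃ t u : ℕ → ℂ, IsULFactorization a b κ s t u) ∧
    ∀ t u r : ℕ → ℂ, IsULFactorization a b κ s t u → (∀ j, r j ^ 2 = t j) →
      ∃ U Ut : EllTwo →L[ℂ] EllTwo,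
        HasMatrix U (upperFactor u r) ∧
        HasMatrix Ut (upperFactor u r).transpose ∧
        J - κ • (1 : EllTwo →L[ℂ] EllTwo) = U * Ut ∧
        spectrum ℂ (Ut * U + κ • (1 : EllTwo →L[ℂ] EllTwo)) = spectrum ℂ J ∪ {κ} := by
  have hreal := hab.im_eq_zero hL
  have hκ : κ.im ≠ 0 := hκs.elim (fun h => h.1.ne') fun h => h.1.ne
  have hκs' : κ.im * s.im ≤ 0 := hκs.elim (fun h => mul_nonpos_of_nonneg_of_nonpos h.1.le h.2)
    fun h => mul_nonpos_of_nonpos_of_nonneg h.1.le h.2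
  refine ⟨exists_isULFactorization hκ hreal hκs', fun t u r hUL hr => ?_⟩
  obtain ⟨ht0, hu0, -, -⟩ := isULFactorization_iff.1 hUL
  obtain ⟨C, hC⟩ := hUL.bounded hab.1 hκ hreal hκs' (M := ‖J‖)
    (fun k => jacobiMatrix_succ_right a b k ▸ hJ.norm_le k (k + 1))
    (fun k => jacobiMatrix_diag a b k ▸ hJ.norm_le k k)
  obtain ⟨U, Ut, hU, hUt0, hUt⟩ := exists_bidiagonal (α := fun k => u k * r k)
    (β := fun k => r (k + 1)) (C := C + 1)
    (fun k => norm_le_of_sq_eq (by rw [mul_pow, hr]) (hC k).1)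
    (fun k => norm_le_of_sq_eq (hr (k + 1)) (hC k).2)
  have hUm : HasMatrix U (upperFactor u r) := by
    intro i j
    rw [hU, stdVec_apply, stdVec_apply, upperFactor, unitUpper]
    rcases eq_or_ne j i with rfl | h1
    · simp
    · rcases eq_or_ne j (i + 1) with rfl | h2
      · simp
      · simp [h1, h2, h1.symm, h2.symm]
  have hUtm : HasMatrix Ut (upperFactor u r).transpose := by
    rintro (_ | i) j
    · rw [hUt0, stdVec_apply, Matrix.transpose_apply, upperFactor, unitUpper]
      rcases eq_or_ne 0 j with rfl | h1
      · simp
      · simp [h1]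
    · rw [hUt, stdVec_apply, stdVec_apply, Matrix.transpose_apply, upperFactor, unitUpper]
      rcases eq_or_ne (i + 1) j with rfl | h1
      · simp
      · rcases eq_or_ne i j with rfl | h2
        · simp
        · simp [h1, h2]
  have hfac : J - κ • (1 : EllTwo →L[ℂ] EllTwo) = U * Ut := by
    refine HasMatrix.unique
      (A := fun i j => jacobiMatrix a b i j - if i = j then κ else 0) (fun i j => ?_) fun i j => ?_
    · change (J (stdVec j) : ℕ → ℂ) i - κ * (stdVec j : ℕ → ℂ) i = _
      rw [hJ, stdVec_apply, mul_ite, mul_one, mul_zero]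
    · change (U (Ut (stdVec j)) : ℕ → ℂ) i = _
      refine Eq.trans ?_ (hUL.2.2 i j).symm
      rw [hU, hUtm, hUtm, finsum_unitUpper, Matrix.transpose_apply,
        Matrix.transpose_apply, upperFactor, upperFactor, ← hr, ← hr]
      ring
  have hJsa : IsSelfAdjoint J := hJ.isSelfAdjoint fun i j => by
    rw [jacobiMatrix_comm, jacobiMatrix]
    have hstar {z : ℂ} (hz : z.im = 0) : star z = z := Complex.conj_eq_iff_im.2 hz
    split_ifs
    exacts [hstar (hreal _).2, hstar (hreal _).1, hstar (hreal _).1, star_zero _]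
  have hunit : IsUnit (U * Ut) := by
    have : κ ∉ spectrum ℂ J := fun h => hκ (hJsa.im_eq_zero_of_mem_spectrum h)
    rw [spectrum.notMem_iff, Algebra.algebraMap_eq_smul_one] at this
    rw [← hfac, ← neg_sub]
    exact this.neg
  have hρ2 : (u 0 * r 0) ^ 2 = 1 / s := by rw [mul_pow, hr, ht0, mul_one, hu0]
  -- Invertibility of `Ut * U` would make `U` injective and force `s = m(J; κ)`.
  have hnot : ¬IsUnit (Ut * U) := by
    intro h
    have hinj : Function.Injective U := fun x y hxy => by
      have hl := Ring.inverse_mul_cancel _ h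
      have hx (z : EllTwo) : Ring.inverse (Ut * U) (Ut (U z)) = z :=
        congrArg (fun T : EllTwo →L[ℂ] EllTwo => T z) hl
      rw [← hx x, hxy, hx y]
    have hρ : u 0 * r 0 ≠ 0 := fun h0 => by
      rw [h0, zero_pow two_ne_zero] at hρ2
      exact one_div_ne_zero hs0 hρ2.symm
    have hU0 : U (stdVec 0) = (u 0 * r 0) • stdVec 0 := by
      refine lp.ext (funext fun k => ?_)
      rw [hU, lp.coeFn_smul, Pi.smul_apply, stdVec_apply, stdVec_apply, if_neg k.succ_ne_zero]
      rcases eq_or_ne k 0 with rfl | hk <;> simp [*]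
    apply hsm
    rw [weylM, hfac, inner_inverse_mul_stdVec_zero hρ hU0 hUt0 hunit hinj, hρ2, one_div_one_div]
  refine ⟨U, Ut, hUm, hUtm, hfac, ?_⟩
  have hJ' : J = U * Ut + κ • (1 : EllTwo →L[ℂ] EllTwo) := by rw [← hfac, sub_add_cancel]
  rw [hJ', spectrum_add_smul_one, spectrum_add_smul_one,
    spectrum_mul_comm_eq_union_zero hunit hnot, Set.image_union, Set.image_singleton, zero_add]
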